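/- Graphs are simple and undirected, of arbitrary cardinality. A ray is a one-way infinite path, i.e. a graph isomorphic to the graph on $\mathbb{N}$ in which $m$ and $n$ are adjacent if and only if $|m-n|=1$; a $2$-ray is a vertex-disjoint union of two rays. A graph $H$ is called edge-ubiquitous if every graph $G$ which, for every $k\in\mathbb{N}$, contains a family of $k$ pairwise edge-disjoint subgraphs each isomorphic to $H$ also contains an infinite family of pairwise edge-disjoint subgraphs each isomorphic to $H$. The $2$-ray is edge-ubiquitous: every graph $G$ that contains, for every $k\in\mathbb{N}$, $k$ pairwise edge-disjoint $2$-rays contains infinitely many pairwise edge-disjoint $2$-rays. -/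

import Mathlib

open SimpleGraph

universe u w

/-- `G` has a family, indexed by `ι`, of pairwise edge-disjoint subgraphs
each of which is isomorphic to `H`. -/
def HasEdgeDisjointFamily {V W : Type*} (ι : Type*) (G : SimpleGraph V) (H : SimpleGraph W) :
    Prop :=
  ∃ S : ι → G.Subgraph,
    (∀ i, Nonempty ((S i).coe ≃g H)) ∧
    ∀ i j, i ≠ j → Disjoint (S i).edgeSet (S j).edgeSet

/-- `G` has arbitrarily many edge-disjoint `H`: for every natural number `k`
there is a family of `k` edge-disjoint subgraphs of `G`, each isomorphic to `H`. -/
def HasArbitrarilyManyEdgeDisjoint {V W : Type*} (G : SimpleGraph V) (H : SimpleGraph W) : Prop :=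
  ∀ k : ℕ, HasEdgeDisjointFamily (Fin k) G H

/-- `G` has infinitely many edge-disjoint `H`: there is an infinite family of
edge-disjoint subgraphs of `G`, each isomorphic to `H`. (If `H` has an edge, the members of
such a family are automatically distinct.) -/
def HasInfinitelyManyEdgeDisjoint {V W : Type*} (G : SimpleGraph V) (H : SimpleGraph W) : Prop :=
  HasEdgeDisjointFamily ℕ G H

/-- `H` is edge-ubiquitous (among graphs whose vertex type lies in the universe `u`): every graph having
arbitrarily many edge-disjoint `H` also has infinitely many edge-disjoint `H`. -/
def IsEdgeUbiquitous {W : Type w} (H : SimpleGraph W) : Prop :=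
  ∀ (V : Type u) (G : SimpleGraph V),
    HasArbitrarilyManyEdgeDisjoint G H → HasInfinitelyManyEdgeDisjoint G H

/-- The ray: the one-way infinite path on the vertices `0, 1, 2, …`, consecutive numbers being
adjacent. -/
def rayGraph : SimpleGraph ℕ := hasse ℕ

/-- The `2`-ray: the vertex-disjoint union of two rays. -/
def twoRayGraph : SimpleGraph (ℕ ⊕ ℕ) := rayGraph ⊕g rayGraph

/-! Discarding initial segments makes the graph locally finite (`exists_locallyFinite_le`). Then
take a maximal vertex set `I` such that Hall's condition still holds for choosing from each closed
neighbourhood a vertex outside `I`.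

If `I` is infinite, Hall's theorem gives an injection `f` moving vertices along edges and missing
`I`. The `f`-orbits of the points of `I` are infinitely many vertex-disjoint rays, which are paired
up (`exists_infinite_family_of_avoiding`).

If `I` is finite, maximality makes finite sets with at most `2|I|` outer boundary vertices cofinal.
Each 2-ray crosses such a boundary in one of boundedly many patterns, so pigeonhole yields families
of every size whose members share a pattern at suitable boundaries. Members of successive families
are glued there (`exists_infinite_family_of_patterns`). Gluing may reconnect strands and create
cycles or double rays, but it preserves in- and out-degrees and hence the two sources, which
suffices: in a flow, two sources start two disjoint rays. -/

/-- A directed relation all of whose components are directed rays, double rays or cycles: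
every vertex has at most one successor and at most one predecessor, and a vertex with a
predecessor has a successor. -/
structure IsFlow {V : Type*} (D : V → V → Prop) : Prop where
  succ_unique : ∀ {u v w}, D u v → D u w → v = w
  pred_unique : ∀ {u v w}, D u w → D v w → u = v
  continues : ∀ {u v}, D u v → ∃ w, D v w

/-- Distinct sources of a flow start vertex-disjoint directed rays. -/
theorem IsFlow.exists_rays {V ι : Type*} {D : V → V → Prop} (hD : IsFlow D) (a : ι → V)
    (ha : Function.Injective a) (hout : ∀ i, ∃ w, D (a i) w) (hin : ∀ i u, ¬ D u (a i)) :
    ∃ r : ι × ℕ → V, Function.Injective r ∧ ∀ i n, D (r (i, n)) (r (i, n + 1)) := by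
  classical
  let f : V → V := fun v => if h : ∃ w, D v w then h.choose else v
  have hf : ∀ v, (∃ w, D v w) → D v (f v) := by
    intro v h
    simp only [f, dif_pos h]
    exact h.choose_spec
  have hstep : ∀ i n, D (f^[n] (a i)) (f^[n + 1] (a i)) := by
    intro i n
    induction n with
    | zero => exact hf _ (hout i)
    | succ n ih =>
      rw [Function.iterate_succ_apply' f (n + 1)]
      exact hf _ (hD.continues ih)
  -- Unique predecessors let both orbits be traced back `n` steps; a source then cannot be a later
  -- point of any orbit.
  have key : ∀ n i j k, f^[n] (a i) = f^[n + k] (a j) → i = j ∧ k = 0 := by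
    intro n
    induction n with
    | zero =>
      intro i j k h
      rcases k with _ | k
      · exact ⟨ha (by simpa using h), rfl⟩
      · exfalso
        have := hstep j k
        simp only [zero_add, Function.iterate_zero, id] at h
        rw [← h] at this
        exact hin _ _ this
    | succ n ih =>
      intro i j k h
      apply ih
      have h1 := hstep i n
      have h2 := hstep j (n + k)
      rw [show n + k + 1 = n + 1 + k by omega, ← h] at h2
      exact hD.pred_unique h1 h2
  refine ⟨fun p => f^[p.2] (a p.1), ?_, hstep⟩
  rintro ⟨i, n⟩ ⟨j, m⟩ h
  rcases le_total n m with hnm | hnm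
  · obtain ⟨k, rfl⟩ := Nat.exists_eq_add_of_le hnm
    obtain ⟨rfl, rfl⟩ := key n i j k h
    rfl
  · obtain ⟨k, rfl⟩ := Nat.exists_eq_add_of_le hnm
    obtain ⟨rfl, rfl⟩ := key m j i k h.symm
    rfl

/-! ### Parametrised 2-rays, their arcs and tails -/

/-- An injective parametrisation of a `2`-ray of `G`. -/
structure IsTwoRay {V : Type*} (G : SimpleGraph V) (r : Bool × ℕ → V) : Prop where
  inj : Function.Injective r
  adj : ∀ b n, G.Adj (r (b, n)) (r (b, n + 1))

/-- The directed edges of a parametrised `2`-ray. -/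
def Arc {V : Type*} (r : Bool × ℕ → V) (u v : V) : Prop :=
  ∃ b n, r (b, n) = u ∧ r (b, n + 1) = v

/-- Two parametrised `2`-rays have no undirected edge in common. -/
def ArcDisjoint {V : Type*} (r s : Bool × ℕ → V) : Prop :=
  ∀ u v, Arc r u v → ¬ Arc s u v ∧ ¬ Arc s v u

/-- The tail of a parametrised `2`-ray, omitting `m` vertices of either ray. -/
def tail {V : Type*} (m : ℕ) (r : Bool × ℕ → V) : Bool × ℕ → V := fun p => r (p.1, p.2 + m)

section TwoRay

variable {V : Type*} {G : SimpleGraph V} {r s : Bool × ℕ → V}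

theorem IsTwoRay.arc_adj (h : IsTwoRay G r) {u v : V} (huv : Arc r u v) : G.Adj u v := by
  obtain ⟨b, n, rfl, rfl⟩ := huv
  exact h.adj b n

theorem IsTwoRay.mono {G' : SimpleGraph V} (h : IsTwoRay G r) (hG : G ≤ G') : IsTwoRay G' r :=
  ⟨h.inj, fun b n => hG (h.adj b n)⟩

theorem isFlow_arc (h : Function.Injective r) : IsFlow (Arc r) where
  succ_unique := by
    rintro u v w ⟨b, n, rfl, rfl⟩ ⟨b', n', h1, rfl⟩
    have := h h1
    simp only [Prod.mk.injEq] at this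
    rw [this.1, this.2]
  pred_unique := by
    rintro u v w ⟨b, n, rfl, rfl⟩ ⟨b', n', rfl, h1⟩
    have := h h1
    simp only [Prod.mk.injEq, Nat.add_right_cancel_iff] at this
    rw [this.1, this.2]
  continues := by
    rintro u v ⟨b, n, rfl, rfl⟩
    exact ⟨_, b, n + 1, rfl, rfl⟩

theorem arc_of_arc_tail {m : ℕ} {u v : V} (h : Arc (tail m r) u v) : Arc r u v := by
  obtain ⟨b, n, rfl, rfl⟩ := h
  exact ⟨b, n + m, rfl, by simp only [tail]; congr 2; omega⟩

theorem ArcDisjoint.mono {r' s' : Bool × ℕ → V} (h : ArcDisjoint r s)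
    (hr : ∀ u v, Arc r' u v → Arc r u v) (hs : ∀ u v, Arc s' u v → Arc s u v) :
    ArcDisjoint r' s' :=
  fun u v huv => ⟨fun h' => (h u v (hr _ _ huv)).1 (hs _ _ h'),
    fun h' => (h u v (hr _ _ huv)).2 (hs _ _ h')⟩

theorem tail_injective (h : Function.Injective r) (m : ℕ) : Function.Injective (tail m r) := by
  rintro ⟨b, n⟩ ⟨b', n'⟩ h1
  have := h h1
  simpa using this

theorem IsTwoRay.tail (h : IsTwoRay G r) (m : ℕ) : IsTwoRay G (tail m r) :=
  ⟨tail_injective h.inj m, fun b n => h.arc_adj (arc_of_arc_tail ⟨b, n, rfl, rfl⟩)⟩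

/-- Every `2`-ray has a tail avoiding a given finite set. -/
theorem exists_tail_notMem (h : Function.Injective r) (F : Finset V) :
    ∃ m, ∀ p, tail m r p ∉ F := by
  have hfin : (r ⁻¹' (F : Set V)).Finite := F.finite_toSet.preimage h.injOn
  obtain ⟨m, hm⟩ := (hfin.image Prod.snd).bddAbove
  refine ⟨m + 1, fun p hp => ?_⟩
  have : p.2 + (m + 1) ≤ m := hm ⟨(p.1, p.2 + (m + 1)), hp, rfl⟩
  omega

theorem IsFlow.exists_isTwoRay {D : V → V → Prop} (hD : IsFlow D)
    (hG : ∀ u v, D u v → G.Adj u v) (a : Bool → V) (ha : Function.Injective a)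
    (hout : ∀ b, ∃ w, D (a b) w) (hin : ∀ b u, ¬ D u (a b)) :
    ∃ r, IsTwoRay G r ∧ ∀ u v, Arc r u v → D u v := by
  obtain ⟨r, hr, hrD⟩ := hD.exists_rays a ha hout hin
  refine ⟨r, ⟨hr, fun b n => hG _ _ (hrD b n)⟩, ?_⟩
  rintro u v ⟨b, n, rfl, rfl⟩
  exact hrD b n

end TwoRay

/-! ### Edge-disjoint families as parametrised `2`-rays -/

theorem rayGraph_adj_iff {m n : ℕ} : rayGraph.Adj m n ↔ m + 1 = n ∨ n + 1 = m := by
  simp [rayGraph, Nat.covBy_iff_add_one_eq]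

theorem HasEdgeDisjointFamily.exists_isTwoRay {V ι : Type*} {G : SimpleGraph V}
    (h : HasEdgeDisjointFamily ι G twoRayGraph) :
    ∃ r : ι → Bool × ℕ → V, (∀ i, IsTwoRay G (r i)) ∧
      ∀ i j, i ≠ j → ArcDisjoint (r i) (r j) := by
  obtain ⟨S, hS, hdis⟩ := h
  let e := fun i => (hS i).some
  let r : ι → Bool × ℕ → V := fun i p => ((e i).symm (Equiv.boolProdEquivSum ℕ p)).1
  have hadj : ∀ i b n, (S i).Adj (r i (b, n)) (r i (b, n + 1)) := by
    intro i b n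
    have : twoRayGraph.Adj (Equiv.boolProdEquivSum ℕ (b, n))
        (Equiv.boolProdEquivSum ℕ (b, n + 1)) := by
      cases b <;> simp [twoRayGraph, rayGraph_adj_iff]
    exact (e i).symm.map_rel_iff.2 this
  have harc : ∀ i u v, Arc (r i) u v → (S i).Adj u v := by
    rintro i u v ⟨b, n, rfl, rfl⟩
    exact hadj i b n
  refine ⟨r, fun i => ⟨?_, fun b n => (hadj i b n).adj_sub⟩, fun i j hij u v hu => ?_⟩
  · exact Subtype.val_injective.comp
      ((e i).symm.injective.comp (Equiv.boolProdEquivSum ℕ).injective)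
  · have hd := Set.disjoint_left.1 (hdis i j hij) (Subgraph.mem_edgeSet.2 (harc i u v hu))
    rw [Subgraph.mem_edgeSet] at hd
    exact ⟨fun h => hd (harc j u v h), fun h => hd (harc j v u h).symm⟩

/-- The subgraph traced by a parametrised `2`-ray. -/
def IsTwoRay.toSubgraph {V : Type*} {G : SimpleGraph V} {r : Bool × ℕ → V} (h : IsTwoRay G r) :
    G.Subgraph where
  verts := Set.range r
  Adj u v := Arc r u v ∨ Arc r v u
  adj_sub := by
    rintro u v (h1 | h1)
    · exact h.arc_adj h1
    · exact (h.arc_adj h1).symm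
  edge_vert := by
    rintro u v (⟨b, n, rfl, rfl⟩ | ⟨b, n, rfl, rfl⟩)
    · exact ⟨_, rfl⟩
    · exact ⟨_, rfl⟩
  symm := ⟨fun _ _ h => h.symm⟩

theorem arc_apply_iff {V : Type*} {r : Bool × ℕ → V} (h : Function.Injective r)
    {p q : Bool × ℕ} : Arc r (r p) (r q) ↔ p.1 = q.1 ∧ p.2 + 1 = q.2 := by
  constructor
  · rintro ⟨b, n, h1, h2⟩
    rw [← h h1, ← h h2]
    exact ⟨rfl, rfl⟩
  · rintro ⟨h1, h2⟩
    exact ⟨p.1, p.2, rfl, by rw [h1, h2]⟩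

theorem IsTwoRay.nonempty_iso {V : Type*} {G : SimpleGraph V} {r : Bool × ℕ → V}
    (h : IsTwoRay G r) : Nonempty (h.toSubgraph.coe ≃g twoRayGraph) := by
  refine ⟨RelIso.symm ⟨(Equiv.boolProdEquivSum ℕ).symm.trans (Equiv.ofInjective r h.inj), ?_⟩⟩
  intro x y
  change Arc r (r _) (r _) ∨ Arc r (r _) (r _) ↔ _
  rw [arc_apply_iff h.inj, arc_apply_iff h.inj]
  rcases x with x | x <;> rcases y with y | y <;>
    simp [twoRayGraph, rayGraph_adj_iff]

theorem hasEdgeDisjointFamily_of_isTwoRay {V ι : Type*} {G : SimpleGraph V}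
    (r : ι → Bool × ℕ → V) (hr : ∀ i, IsTwoRay G (r i))
    (hdis : ∀ i j, i ≠ j → ArcDisjoint (r i) (r j)) :
    HasEdgeDisjointFamily ι G twoRayGraph := by
  refine ⟨fun i => (hr i).toSubgraph, fun i => (hr i).nonempty_iso, fun i j hij => ?_⟩
  rw [Set.disjoint_left]
  intro x
  induction x using Sym2.ind with
  | _ u v =>
    rw [Subgraph.mem_edgeSet, Subgraph.mem_edgeSet]
    rintro (h1 | h1) (h2 | h2)
    · exact (hdis i j hij _ _ h1).1 h2
    · exact (hdis i j hij _ _ h1).2 h2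
    · exact (hdis i j hij _ _ h1).2 h2
    · exact (hdis i j hij _ _ h1).1 h2

/-! ### Gluing flows along nested separators -/

/-- The relation that follows `Y c` on the pairs first met by `A c`. -/
def glue {V : Type*} (A : ℕ → Set V) (Y : ℕ → V → V → Prop) (u v : V) : Prop :=
  ∃ c, Y c u v ∧ (u ∈ A c ∨ v ∈ A c) ∧ ∀ c' < c, u ∉ A c' ∧ v ∉ A c'

section Glue

variable {V : Type*} {G : SimpleGraph V} {A : ℕ → Set V} {Y : ℕ → V → V → Prop}

theorem glue_flip {u v : V} : glue A (fun c => flip (Y c)) u v ↔ glue A Y v u := by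
  simp only [glue, flip, or_comm, and_comm]

/-- An edge joins equal or consecutive layers, so at a vertex of layer `A (c + 1) \ A c` only `Y c`
and `Y (c + 1)` matter: the former on edges back into `A c`, the latter on all others. -/
theorem glue_iff (hmono : Monotone A) (hA : ∀ c u v, u ∈ A c → G.Adj u v → v ∈ A (c + 1))
    (hY : ∀ c u v, Y c u v → G.Adj u v) {c : ℕ} {u v : V} (hv : v ∈ A (c + 1)) (hv' : v ∉ A c) :
    glue A Y u v ↔ (u ∈ A c ∧ Y c u v) ∨ (u ∉ A c ∧ Y (c + 1) u v) := by
  constructor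
  · rintro ⟨c₀, hy, hc, hlt⟩
    have h1 : c₀ ≤ c + 1 := by
      by_contra h
      exact (hlt (c + 1) (by omega)).2 hv
    by_cases hv0 : v ∈ A c₀
    · have h2 : ¬ c₀ ≤ c := fun h => hv' (hmono h hv0)
      obtain rfl : c₀ = c + 1 := by omega
      exact .inr ⟨(hlt c (by omega)).1, hy⟩
    · have hu : u ∈ A c₀ := by tauto
      have h2 : ¬ c₀ + 1 ≤ c := fun h => hv' (hmono h (hA _ _ _ hu (hY _ _ _ hy)))
      have h3 : c₀ ≠ c + 1 := by rintro rfl; exact hv0 hv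
      obtain rfl : c₀ = c := by omega
      exact .inl ⟨hu, hy⟩
  · rintro (⟨hu, hy⟩ | ⟨hu, hy⟩)
    · refine ⟨c, hy, .inl hu, fun c' hc' => ⟨fun h => ?_, fun h => hv' (hmono hc'.le h)⟩⟩
      exact hv' (hmono (show c' + 1 ≤ c from hc') (hA _ _ _ h (hY _ _ _ hy)))
    · exact ⟨c + 1, hy, .inr hv, fun c' hc' => ⟨fun h => hu (hmono (by omega) h),
        fun h => hv' (hmono (by omega) h)⟩⟩

theorem glue_iff' (hmono : Monotone A) (hA : ∀ c u v, u ∈ A c → G.Adj u v → v ∈ A (c + 1))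
    (hY : ∀ c u v, Y c u v → G.Adj u v) {c : ℕ} {u v : V} (hv : v ∈ A (c + 1)) (hv' : v ∉ A c) :
    glue A Y v u ↔ (u ∈ A c ∧ Y c v u) ∨ (u ∉ A c ∧ Y (c + 1) v u) := by
  rw [← glue_flip]
  exact glue_iff (Y := fun c => flip (Y c)) hmono hA (fun c u v h => (hY c v u h).symm) hv hv'

theorem exists_level (h0 : A 0 = ∅) {v : V} (hv : ∃ c, v ∈ A c) :
    ∃ c, v ∈ A (c + 1) ∧ v ∉ A c := by
  classical
  rcases h : Nat.find hv with _ | c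
  · have := Nat.find_spec hv
    rw [h, h0] at this
    exact this.elim
  · exact ⟨c, h ▸ Nat.find_spec hv, Nat.find_min hv (by omega)⟩

theorem exists_mem_of_glue (hA : ∀ c u v, u ∈ A c → G.Adj u v → v ∈ A (c + 1))
    (hY : ∀ c u v, Y c u v → G.Adj u v) {u v : V} (h : glue A Y u v) : ∃ c, v ∈ A c := by
  obtain ⟨c, hy, hu | hv, -⟩ := h
  · exact ⟨_, hA _ _ _ hu (hY _ _ _ hy)⟩
  · exact ⟨_, hv⟩

/-- Flows that cross each boundary `A c` in the same pattern as their successor glue to a flow. -/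
theorem isFlow_glue (hmono : Monotone A) (h0 : A 0 = ∅)
    (hA : ∀ c u v, u ∈ A c → G.Adj u v → v ∈ A (c + 1))
    (hY : ∀ c u v, Y c u v → G.Adj u v) (hflow : ∀ c, IsFlow (Y c))
    (hin : ∀ c v, v ∉ A c → ((∃ u ∈ A c, Y c u v) ↔ ∃ u ∈ A c, Y (c + 1) u v))
    (hout : ∀ c v, v ∉ A c → ((∃ u ∈ A c, Y c v u) ↔ ∃ u ∈ A c, Y (c + 1) v u)) :
    IsFlow (glue A Y) where
  succ_unique := by
    intro u v w h1 h2
    obtain ⟨c, hc, hc'⟩ := exists_level h0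
      (exists_mem_of_glue (Y := fun c => flip (Y c)) hA (fun c u v h => (hY c v u h).symm)
        (glue_flip.2 h1))
    rw [glue_iff' hmono hA hY hc hc'] at h1 h2
    rcases h1 with ⟨a1, b1⟩ | ⟨a1, b1⟩ <;> rcases h2 with ⟨a2, b2⟩ | ⟨a2, b2⟩
    · exact (hflow _).succ_unique b1 b2
    · obtain ⟨x, hx, hx'⟩ := (hout c u hc').1 ⟨v, a1, b1⟩
      exact absurd ((hflow _).succ_unique hx' b2 ▸ hx) a2
    · obtain ⟨x, hx, hx'⟩ := (hout c u hc').1 ⟨w, a2, b2⟩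
      exact absurd ((hflow _).succ_unique hx' b1 ▸ hx) a1
    · exact (hflow _).succ_unique b1 b2
  pred_unique := by
    intro v w u h1 h2
    obtain ⟨c, hc, hc'⟩ := exists_level h0 (exists_mem_of_glue hA hY h1)
    rw [glue_iff hmono hA hY hc hc'] at h1 h2
    rcases h1 with ⟨a1, b1⟩ | ⟨a1, b1⟩ <;> rcases h2 with ⟨a2, b2⟩ | ⟨a2, b2⟩
    · exact (hflow _).pred_unique b1 b2
    · obtain ⟨x, hx, hx'⟩ := (hin c u hc').1 ⟨v, a1, b1⟩
      exact absurd ((hflow _).pred_unique hx' b2 ▸ hx) a2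
    · obtain ⟨x, hx, hx'⟩ := (hin c u hc').1 ⟨w, a2, b2⟩
      exact absurd ((hflow _).pred_unique hx' b1 ▸ hx) a1
    · exact (hflow _).pred_unique b1 b2
  continues := by
    intro u v h1
    obtain ⟨c, hc, hc'⟩ := exists_level h0 (exists_mem_of_glue hA hY h1)
    rw [glue_iff hmono hA hY hc hc'] at h1
    -- Matching patterns turn an entry from `A c` by `Y c` into one by `Y (c + 1)`, which continues
    -- beyond `v`. If it continues back into `A c`, the exit pattern supplies a `Y c` arc instead.
    have h2 : ∃ x, Y (c + 1) x v := by
      rcases h1 with ⟨a1, b1⟩ | ⟨a1, b1⟩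
      · obtain ⟨x, -, hx'⟩ := (hin c v hc').1 ⟨u, a1, b1⟩
        exact ⟨x, hx'⟩
      · exact ⟨u, b1⟩
    obtain ⟨x, hx⟩ := h2
    obtain ⟨w, hw⟩ := (hflow _).continues hx
    by_cases hwA : w ∈ A c
    · obtain ⟨w', h3, h4⟩ := (hout c v hc').2 ⟨w, hwA, hw⟩
      exact ⟨w', (glue_iff' hmono hA hY hc hc').2 (.inl ⟨h3, h4⟩)⟩
    · exact ⟨w, (glue_iff' hmono hA hY hc hc').2 (.inr ⟨hwA, hw⟩)⟩

end Glue

/-! ### Disjoint rays or bounded separators -/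

section Hall

variable {V : Type*} [DecidableEq V]

open Classical in
/-- Hall's condition for injections choosing from `t v` an element outside `I`. -/
def HallAvoiding (t : V → Finset V) (I : Set V) : Prop :=
  ∀ A : Finset V, A.card ≤ ((A.biUnion t).filter (· ∉ I)).card

-- Zorn applies because Hall's condition has finite character: each finite `A` sees only finitely
-- many points of `I`, and these already lie in one member of a chain.
open Classical in
theorem exists_maximal_hallAvoiding (t : V → Finset V) (ht : ∀ v, v ∈ t v) :
    ∃ I, Maximal (HallAvoiding t) I := by
  refine zorn_subset {I | HallAvoiding t I} ?_
  intro c hc hchain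
  rcases c.eq_empty_or_nonempty with rfl | hne
  · refine ⟨∅, fun A => Finset.card_le_card fun v hv => ?_, by simp⟩
    simpa using ⟨v, hv, ht v⟩
  refine ⟨⋃₀ c, fun A => ?_, fun s hs => Set.subset_sUnion_of_mem hs⟩
  have hdir : DirectedOn (· ⊆ ·) c := hchain.directedOn
  obtain ⟨s, hs, hsub⟩ := DirectedOn.exists_mem_subset_of_finset_subset_biUnion (f := id) hne hdir
    (s := (A.biUnion t).filter (· ∈ ⋃₀ c)) (by
      intro v hv
      simpa using (Finset.mem_filter.1 hv).2)
  refine (hc hs A).trans (Finset.card_le_card fun v hv => ?_)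
  rw [Finset.mem_filter] at hv ⊢
  exact ⟨hv.1, fun h => hv.2 (hsub (by simpa using ⟨by simpa using hv.1, by simpa using h⟩))⟩

-- Submodularity of `A ↦ |N(A) \ I|`, together with Hall's condition on `A ∩ B`.
open Classical in
theorem HallAvoiding.tight_union {t : V → Finset V} {I : Set V} (hI : HallAvoiding t I)
    {A B : Finset V} (hA : ((A.biUnion t).filter (· ∉ I)).card ≤ A.card)
    (hB : ((B.biUnion t).filter (· ∉ I)).card ≤ B.card) :
    (((A ∪ B).biUnion t).filter (· ∉ I)).card ≤ (A ∪ B).card := by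
  have h1 := Finset.card_union_add_card_inter ((A.biUnion t).filter (· ∉ I))
    ((B.biUnion t).filter (· ∉ I))
  have h2 := Finset.card_union_add_card_inter A B
  have h3 := hI (A ∩ B)
  have h4 : (((A ∩ B).biUnion t).filter (· ∉ I)).card ≤
      ((A.biUnion t).filter (· ∉ I) ∩ (B.biUnion t).filter (· ∉ I)).card := by
    apply Finset.card_le_card
    intro v hv
    simp only [Finset.mem_filter, Finset.mem_biUnion, Finset.mem_inter] at hv ⊢
    obtain ⟨⟨x, ⟨hx, hx'⟩, hv⟩, hvI⟩ := hv
    exact ⟨⟨⟨x, hx, hv⟩, hvI⟩, ⟨x, hx', hv⟩, hvI⟩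
  rw [Finset.union_biUnion, Finset.filter_union]
  omega

open Classical in
/-- Either infinitely many vertices can be simultaneously avoided by an injection selecting from
the sets `t v`, or the finite sets with bounded boundary are cofinal. -/
theorem infinite_avoiding_or_bounded_boundary (t : V → Finset V) (ht : ∀ v, v ∈ t v) :
    (∃ I : Set V, I.Infinite ∧ ∃ f : V → V, Function.Injective f ∧ ∀ v, f v ∈ t v ∧ f v ∉ I) ∨
    ∃ d, ∀ B : Finset V, ∃ A, B ⊆ A ∧ (A.biUnion t \ A).card ≤ d := by
  obtain ⟨I, hI, hmax⟩ := exists_maximal_hallAvoiding t ht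
  by_cases hinf : I.Infinite
  · left
    refine ⟨I, hinf, ?_⟩
    obtain ⟨f, hf, hf'⟩ := (Finset.all_card_le_biUnion_card_iff_exists_injective
      (fun v => (t v).filter (· ∉ I))).1 (by
        intro A
        rw [← Finset.filter_biUnion]
        exact hI A)
    exact ⟨f, hf, fun v => by simpa using hf' v⟩
  right
  rw [Set.not_infinite] at hinf
  -- By maximality, adding `v` to `I` violates Hall's condition at some `A`. Only the loss of `v`
  -- can cause this, so `A` is tight for `I` and `v` is in its neighbourhood.
  have htight : ∀ v ∉ I, ∃ A : Finset V, ((A.biUnion t).filter (· ∉ I)).card ≤ A.card ∧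
      v ∈ A.biUnion t := by
    intro v hv
    have hnot : ¬ HallAvoiding t (insert v I) := fun h =>
      hv (hmax h (Set.subset_insert v I) (Set.mem_insert v I))
    simp only [HallAvoiding, not_forall, not_le] at hnot
    obtain ⟨A, hA⟩ := hnot
    replace hA : ((A.biUnion t).filter (· ∉ insert v I)).card < A.card :=
      lt_of_le_of_lt (le_of_eq (by congr)) hA
    have hsub : (A.biUnion t).filter (· ∉ I) ⊆
        insert v ((A.biUnion t).filter (· ∉ insert v I)) := by
      intro x hx
      by_cases hxv : x = v
      · simp [hxv]
      · rw [Finset.mem_filter] at hx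
        rw [Finset.mem_insert, Finset.mem_filter, Set.mem_insert_iff]
        tauto
    refine ⟨A, ?_, ?_⟩
    · have := (Finset.card_le_card hsub).trans (Finset.card_insert_le _ _)
      omega
    · by_contra hvA
      have : (A.biUnion t).filter (· ∉ I) ⊆ (A.biUnion t).filter (· ∉ insert v I) := by
        intro x hx
        rw [Finset.mem_filter] at hx ⊢
        refine ⟨hx.1, ?_⟩
        rintro (rfl | h)
        · exact hvA hx.1
        · exact hx.2 h
      have := (hI A).trans (Finset.card_le_card this)
      omega
  have htight' : ∀ B : Finset V, ∃ A : Finset V,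
      ((A.biUnion t).filter (· ∉ I)).card ≤ A.card ∧ ∀ v ∈ B, v ∉ I → v ∈ A.biUnion t := by
    intro B
    induction B using Finset.induction_on with
    | empty => exact ⟨∅, by simp, by simp⟩
    | insert v B _ ih =>
      obtain ⟨A, hA, hB⟩ := ih
      by_cases hv : v ∈ I
      · refine ⟨A, hA, fun x hx hxI => ?_⟩
        rcases Finset.mem_insert.1 hx with rfl | hx
        · exact absurd hv hxI
        · exact hB x hx hxI
      · obtain ⟨A', hA', hv'⟩ := htight v hv
        refine ⟨A ∪ A', hI.tight_union hA hA', fun x hx hxI => ?_⟩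
        rw [Finset.union_biUnion, Finset.mem_union]
        rcases Finset.mem_insert.1 hx with rfl | hx
        · exact .inr hv'
        · exact .inl (hB x hx hxI)
  -- Tightness of `A` bounds `N(A) \ A` by `|I|`. Adding `B` contributes at most the points of `I`,
  -- as `N(B) \ I` already lies in `N(A)`.
  refine ⟨hinf.toFinset.card + hinf.toFinset.card, fun B => ?_⟩
  obtain ⟨A, hA, hB⟩ := htight' (B.biUnion t)
  refine ⟨A ∪ B, Finset.subset_union_right, ?_⟩
  have hsub : (A ∪ B).biUnion t \ (A ∪ B) ⊆ (A.biUnion t \ A) ∪ hinf.toFinset := by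
    intro x hx
    rw [Finset.union_biUnion, Finset.mem_sdiff, Finset.mem_union, Finset.mem_union] at hx
    rw [Finset.mem_union, Finset.mem_sdiff, Set.Finite.mem_toFinset]
    have := hB x
    tauto
  have hAsub : A ⊆ A.biUnion t := fun v hv => Finset.mem_biUnion.2 ⟨v, hv, ht v⟩
  have h1 := Finset.card_sdiff_add_card_eq_card hAsub
  have h2 : (A.biUnion t).card ≤
      ((A.biUnion t).filter (· ∉ I)).card + hinf.toFinset.card := by
    refine le_trans (Finset.card_le_card fun x hx => ?_) (Finset.card_union_le _ _)
    rw [Finset.mem_union, Finset.mem_filter, Set.Finite.mem_toFinset]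
    tauto
  have h3 := (Finset.card_le_card hsub).trans (Finset.card_union_le _ _)
  omega

end Hall

/-! ### Passing to a locally finite subgraph -/

/-- A countable family in `V` is exhausted by an increasing sequence of finite sets. -/
theorem exists_finset_exhaustion {V J : Type*} [Countable J] (f : J → V) :
    ∃ H : ℕ → Finset V, ∀ j, ∀ᶠ i in Filter.atTop, f j ∈ H i := by
  classical
  obtain ⟨e, he⟩ := exists_injective_nat J
  have hfin : ∀ i, {j | e j ≤ i}.Finite := fun i => (Set.finite_Iic i).preimage he.injOn
  refine ⟨fun i => (hfin i).toFinset.image f, fun j => ?_⟩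
  filter_upwards [Filter.eventually_ge_atTop (e j)] with i hi
  exact Finset.mem_image_of_mem f (by simpa using hi)

/-- Trim the `k`-th family to avoid the `k`-th set of a finite exhaustion. Each vertex then lies on
finitely many of the remaining 2-rays, and each has at most one arc into it and one out of it. -/
theorem exists_locallyFinite_le {V : Type*} {G : SimpleGraph V}
    (r : (k : ℕ) → Fin k → Bool × ℕ → V) (hr : ∀ k x, IsTwoRay G (r k x))
    (hdis : ∀ k x y, x ≠ y → ArcDisjoint (r k x) (r k y)) :
    ∃ G' ≤ G, (∀ v, (G'.neighborSet v).Finite) ∧ ∃ s : (k : ℕ) → Fin k → Bool × ℕ → V,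
      (∀ k x, IsTwoRay G' (s k x)) ∧ ∀ k x y, x ≠ y → ArcDisjoint (s k x) (s k y) := by
  obtain ⟨H, hH⟩ := exists_finset_exhaustion
    (fun p : (Σ k, Fin k) × Bool × ℕ => r p.1.1 p.1.2 p.2)
  choose m hm using fun k x => exists_tail_notMem (hr k x).inj (H k)
  let s : (k : ℕ) → Fin k → Bool × ℕ → V := fun k x => tail (m k x) (r k x)
  have hs : ∀ k x, IsTwoRay G (s k x) := fun k x => (hr k x).tail _
  let G' : SimpleGraph V :=
    { Adj := fun u v => ∃ k x, Arc (s k x) u v ∨ Arc (s k x) v u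
      symm := ⟨fun u v ⟨k, x, h⟩ => ⟨k, x, h.symm⟩⟩
      loopless := ⟨by
        rintro v ⟨k, x, h | h⟩ <;> exact G.loopless.irrefl v ((hs k x).arc_adj h)⟩ }
  refine ⟨G', ?_, ?_, s, fun k x => ⟨(hs k x).inj, fun b n => ⟨k, x, .inl ⟨b, n, rfl, rfl⟩⟩⟩,
    fun k x y hxy => (hdis k x y hxy).mono (fun _ _ => arc_of_arc_tail)
      (fun _ _ => arc_of_arc_tail)⟩
  · rintro u v ⟨k, x, h | h⟩
    · exact (hs k x).arc_adj h
    · exact ((hs k x).arc_adj h).symm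
  · intro v
    by_cases hv : ∃ k x p, s k x p = v
    · obtain ⟨k, x, p, rfl⟩ := hv
      obtain ⟨i₀, hi₀⟩ := Filter.eventually_atTop.1 (hH (⟨k, x⟩, (p.1, p.2 + m k x)))
      set v := s k x p with hvdef
      have hfin : (⋃ l ∈ Set.Iio i₀, ⋃ y : Fin l,
          ({w | Arc (s l y) v w} ∪ {w | Arc (s l y) w v})).Finite := by
        refine (Set.finite_Iio i₀).biUnion fun l _ => Set.finite_iUnion fun y => ?_
        refine Set.Finite.union (Set.Subsingleton.finite ?_) (Set.Subsingleton.finite ?_)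
        · exact fun a ha b hb => (isFlow_arc (hs l y).inj).succ_unique ha hb
        · exact fun a ha b hb => (isFlow_arc (hs l y).inj).pred_unique ha hb
      refine hfin.subset ?_
      rintro w ⟨l, y, h⟩
      have hl : l < i₀ := by
        by_contra hl
        have hvH : v ∈ H l := hi₀ l (not_lt.1 hl)
        rcases h with ⟨b, n, h, -⟩ | ⟨b, n, -, h⟩
        · exact hm l y _ (h ▸ hvH)
        · exact hm l y _ (h ▸ hvH)
      simp only [Set.mem_iUnion]
      exact ⟨l, hl, y, h⟩
    · convert Set.finite_empty
      rw [Set.eq_empty_iff_forall_notMem]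
      rintro w ⟨l, y, ⟨b, n, h, -⟩ | ⟨b, n, -, h⟩⟩
      · exact hv ⟨l, y, _, h⟩
      · exact hv ⟨l, y, _, h⟩

/-! ### Gluing along bounded separators -/

/-- The set of vertices outside `C` reached from `C` by `D`. -/
def crossing {V : Type*} (C : Set V) (D : V → V → Prop) : Set V := {v | v ∉ C ∧ ∃ u ∈ C, D u v}

theorem crossing_congr {V : Type*} {C : Set V} {D D' : V → V → Prop}
    (h : crossing C D = crossing C D') {v : V} (hv : v ∉ C) :
    (∃ u ∈ C, D u v) ↔ ∃ u ∈ C, D' u v := by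
  have := Set.ext_iff.1 h v
  simpa [crossing, hv] using this

/-- The pattern in which a parametrised `2`-ray crosses the boundary of `C`: the entries into and
the exits from the complement of `C`. -/
def pattern {V : Type*} (C : Set V) (r : Bool × ℕ → V) : Set V × Set V :=
  (crossing C (Arc r), crossing C (flip (Arc r)))

theorem arc_tail_iff {V : Type*} {C : Set V} {r : Bool × ℕ → V} {m : ℕ}
    (hC : ∀ b n, n ≤ m → r (b, n) ∈ C) {u v : V} (h : u ∉ C ∨ v ∉ C) :
    Arc (tail m r) u v ↔ Arc r u v := by
  refine ⟨arc_of_arc_tail, ?_⟩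
  rintro ⟨b, n, rfl, rfl⟩
  have hn : m ≤ n := by
    by_contra hn
    rcases h with h | h
    · exact h (hC b n (by omega))
    · exact h (hC b (n + 1) (by omega))
  obtain ⟨k, rfl⟩ := Nat.exists_eq_add_of_le hn
  refine ⟨b, k, ?_, ?_⟩ <;> simp only [tail] <;> congr 2 <;> omega

/-- The arcs lost in passing to the tail have both ends in `C`. -/
theorem pattern_tail {V : Type*} {C : Set V} {r : Bool × ℕ → V} {m : ℕ}
    (hC : ∀ b n, n ≤ m → r (b, n) ∈ C) : pattern C (tail m r) = pattern C r := by
  have h1 : ∀ v ∉ C, ∀ u, Arc (tail m r) u v ↔ Arc r u v := fun v hv u =>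
    arc_tail_iff hC (.inr hv)
  have h2 : ∀ v ∉ C, ∀ u, Arc (tail m r) v u ↔ Arc r v u := fun v hv u =>
    arc_tail_iff hC (.inl hv)
  refine Prod.ext ?_ ?_ <;> ext v <;> simp only [pattern, crossing, flip, Set.mem_ofPred_eq]
  · exact and_congr_right fun hv => by simp only [h1 v hv]
  · exact and_congr_right fun hv => by simp only [h2 v hv]

/-- Glue `2`-rays `Y c` with matching patterns into a single `2`-ray, if they all agree, up to
index `n + 1`, with a `2`-ray avoiding `A n` and starting in `A (n + 1)`. -/
theorem exists_glued_twoRay {V : Type*} {G : SimpleGraph V} {A : ℕ → Set V} (hmono : Monotone A)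
    (h0 : A 0 = ∅) (hA : ∀ c u v, u ∈ A c → G.Adj u v → v ∈ A (c + 1))
    {Y : ℕ → Bool × ℕ → V} (hY : ∀ c, IsTwoRay G (Y c))
    (hpat : ∀ c, pattern (A c) (Y c) = pattern (A c) (Y (c + 1))) {n : ℕ}
    (hn : Y n = Y (n + 1)) (havoid : ∀ p, Y n p ∉ A n) (hstart : ∀ b, Y n (b, 0) ∈ A (n + 1)) :
    ∃ r, IsTwoRay G r ∧ ∀ u v, Arc r u v → glue A (fun c => Arc (Y c)) u v := by
  have hadj : ∀ c u v, Arc (Y c) u v → G.Adj u v := fun c u v => (hY c).arc_adj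
  have hflow : IsFlow (glue A (fun c => Arc (Y c))) := by
    refine isFlow_glue hmono h0 hA hadj (fun c => isFlow_arc (hY c).inj) ?_ ?_
    · intro c v hv
      exact crossing_congr (Prod.ext_iff.1 (hpat c)).1 hv
    · intro c v hv
      exact crossing_congr (Prod.ext_iff.1 (hpat c)).2 hv
  refine hflow.exists_isTwoRay ?_ (fun b => Y n (b, 0)) ?_ ?_ ?_
  · rintro u v ⟨c, h, -⟩
    exact hadj c u v h
  · intro b b' h
    simpa using (hY n).inj h
  · intro b
    -- The first arc lies outside `A n`, so the glued relation reads it from `Y (n + 1)`; hence the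
    -- need for `hn`.
    refine ⟨Y n (b, 1), (glue_iff' hmono hA hadj (hstart b) (havoid _)).2 (.inr ⟨havoid _, ?_⟩)⟩
    rw [← hn]
    exact ⟨b, 0, rfl, rfl⟩
  · intro b u h
    have h1 : ¬ Arc (Y n) u (Y n (b, 0)) := by
      rintro ⟨b', m, -, h⟩
      simpa using (hY n).inj h
    rw [glue_iff hmono hA hadj (hstart b) (havoid _)] at h
    rcases h with ⟨-, h⟩ | ⟨-, h⟩
    · exact h1 h
    · rw [← hn] at h
      exact h1 h

/-- Gluing infinitely many edge-disjoint `2`-rays out of finite families `U c` of size `c`. -/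
theorem exists_infinite_family_of_patterns {V : Type*} {G : SimpleGraph V} {A : ℕ → Set V}
    (hmono : Monotone A) (h0 : A 0 = ∅) (hA : ∀ c u v, u ∈ A c → G.Adj u v → v ∈ A (c + 1))
    (U : ℕ → ℕ → Bool × ℕ → V) (hU : ∀ c, ∀ n < c, IsTwoRay G (U c n))
    (hdis : ∀ c, ∀ n < c, ∀ m < c, n ≠ m → ArcDisjoint (U c n) (U c m))
    (hpat : ∀ c, ∀ n < c, pattern (A c) (U c n) = pattern (A c) (U (c + 1) n))
    (l : ℕ → ℕ) (havoid : ∀ n p, tail (l n) (U (n + 1) n) p ∉ A n)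
    (hhead : ∀ n b, ∀ i ≤ l n, U (n + 1) n (b, i) ∈ A (n + 1)) :
    ∃ r : ℕ → Bool × ℕ → V, (∀ n, IsTwoRay G (r n)) ∧
      ∀ n m, n ≠ m → ArcDisjoint (r n) (r m) := by
  -- The `n`-th 2-ray starts in layer `n + 1`, as a tail avoiding `A n`. The same tail serves as a
  -- filler at lower levels, where it meets nothing.
  let Y : ℕ → ℕ → Bool × ℕ → V := fun n c =>
    if c ≤ n + 1 then tail (l n) (U (n + 1) n) else U c n
  have hYle : ∀ n c, c ≤ n + 1 → Y n c = tail (l n) (U (n + 1) n) := fun n c h => if_pos h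
  have hYgt : ∀ n c, n + 1 < c → Y n c = U c n := fun n c h => if_neg (not_le.2 h)
  have hYarc : ∀ n c, n < c → ∀ u v, Arc (Y n c) u v → Arc (U c n) u v := by
    intro n c hc u v h
    rcases Nat.lt_or_ge (n + 1) c with h1 | h1
    · rwa [hYgt n c h1] at h
    · obtain rfl : c = n + 1 := by omega
      rw [hYle n _ le_rfl] at h
      exact arc_of_arc_tail h
  have hex : ∀ n, ∃ r, IsTwoRay G r ∧ ∀ u v, Arc r u v → glue A (fun c => Arc (Y n c)) u v := by
    intro n
    refine exists_glued_twoRay (n := n) hmono h0 hA (fun c => ?_) (fun c => ?_) ?_ ?_ ?_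
    · rcases Nat.lt_or_ge (n + 1) c with h1 | h1
      · rw [hYgt n c h1]
        exact hU c n (by omega)
      · rw [hYle n c h1]
        exact (hU _ n (by omega)).tail _
    · rcases Nat.lt_trichotomy c (n + 1) with h1 | rfl | h1
      · rw [hYle n c h1.le, hYle n (c + 1) h1]
      · rw [hYle n _ le_rfl, hYgt n _ (by omega), pattern_tail (hhead n)]
        exact hpat _ n (by omega)
      · rw [hYgt n c h1, hYgt n _ (by omega)]
        exact hpat c n (by omega)
    · rw [hYle n n (by omega), hYle n _ le_rfl]
    · rw [hYle n n (by omega)]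
      exact havoid n
    · intro b
      rw [hYle n n (by omega)]
      simpa [tail] using hhead n b (l n) le_rfl
  have hlevel : ∀ n c u v, Arc (Y n c) u v → (u ∈ A c ∨ v ∈ A c) → n < c := by
    intro n c u v h huv
    by_contra hc
    rw [hYle n c (by omega)] at h
    obtain ⟨b, i, rfl, rfl⟩ := h
    rcases huv with h | h <;> exact havoid n _ (hmono (not_lt.1 hc) h)
  choose r hr hrglue using hex
  have hcommon : ∀ n m, n ≠ m → ∀ u v c, Arc (Y n c) u v → (u ∈ A c ∨ v ∈ A c) →
      ¬ Arc (Y m c) u v ∧ ¬ Arc (Y m c) v u := by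
    intro n m hnm u v c h huv
    have hn := hlevel n c u v h huv
    by_cases hm : m < c
    · have := hdis c n hn m hm hnm u v (hYarc n c hn u v h)
      exact ⟨fun h' => this.1 (hYarc m c hm _ _ h'), fun h' => this.2 (hYarc m c hm _ _ h')⟩
    · exact ⟨fun h' => hm (hlevel m c u v h' huv), fun h' => hm (hlevel m c v u h' huv.symm)⟩
  refine ⟨r, hr, fun n m hnm u v h => ?_⟩
  obtain ⟨c, hc, huv, hlt⟩ := hrglue n u v h
  have heq : ∀ c', (u ∈ A c' ∨ v ∈ A c') → (∀ c'' < c', u ∉ A c'' ∧ v ∉ A c'') → c' = c := by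
    intro c' h1 h2
    rcases Nat.lt_trichotomy c' c with h3 | h3 | h3
    · have := hlt c' h3
      tauto
    · exact h3
    · have := h2 c h3
      tauto
  have key := hcommon n m hnm u v c hc huv
  refine ⟨fun h' => ?_, fun h' => ?_⟩
  · obtain ⟨c', hc', huv', hlt'⟩ := hrglue m u v h'
    obtain rfl := heq c' huv' hlt'
    exact key.1 hc'
  · obtain ⟨c', hc', huv', hlt'⟩ := hrglue m v u h'
    obtain rfl := heq c' huv'.symm fun c'' h'' => (hlt' c'' h'').symm
    exact absurd hc' key.2

/-! ### Limit colours and bounded boundaries -/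

/-- A finitely valued sequence is constant along the hyperfilter. -/
theorem exists_eventually_eq_hyperfilter {κ : Type*} [Finite κ] (f : ℕ → κ) :
    ∃ p, ∀ᶠ i in (Filter.hyperfilter ℕ : Filter ℕ), f i = p := by
  obtain ⟨p, hp⟩ := ((Filter.hyperfilter ℕ).map f).eq_pure_of_finite
  refine ⟨p, ?_⟩
  have : {p} ∈ (Filter.hyperfilter ℕ).map f := by rw [hp]; exact Ultrafilter.mem_pure.2 rfl
  exact this

/-- Given families of unbounded finite sizes and finitely many colours varying with time, there are
subfamilies of all finite sizes whose members share one limit colour. -/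
theorem exists_uniform_subfamilies {X κ : Type*} [Finite κ] (T : (k : ℕ) → Fin k → X)
    (code : ℕ → X → κ) :
    ∃ p, ∀ c, ∃ k, ∃ e : Fin c ↪ Fin k, ∀ n,
      ∀ᶠ i in (Filter.hyperfilter ℕ : Filter ℕ), code i (T k (e n)) = p := by
  classical
  cases nonempty_fintype κ
  choose lim hlim using fun x => exists_eventually_eq_hyperfilter (fun i => code i x)
  have : Nonempty κ := ⟨lim (T 1 0)⟩
  have h1 : ∀ c, ∃ q, ∃ k, ∃ e : Fin c ↪ Fin k, ∀ n, lim (T k (e n)) = q := by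
    intro c
    obtain ⟨q, hq⟩ := Fintype.exists_le_card_fiber_of_mul_le_card
      (fun x : Fin (Fintype.card κ * c) => lim (T _ x)) (n := c) (by simp)
    obtain ⟨e⟩ := Function.Embedding.nonempty_of_card_le
      (α := Fin c) (β := {x // x ∈ ({x | lim (T _ x) = q} : Finset (Fin (Fintype.card κ * c)))})
      (by rw [Fintype.card_fin, Fintype.card_coe]; exact hq)
    exact ⟨q, _, e.trans (Function.Embedding.subtype _), fun n =>
      (Finset.mem_filter.1 (e n).2).2⟩
  choose q hq using h1
  -- The limit colour may depend on the size; some colour recurs for arbitrarily large sizes, and a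
  -- larger family can be cut down.
  obtain ⟨p, hp⟩ := Finite.exists_infinite_fiber q
  refine ⟨p, fun c => ?_⟩
  obtain ⟨c', hc', hle⟩ := (Set.infinite_coe_iff.1 hp).exists_gt c
  obtain ⟨k, e, he⟩ := hq c'
  refine ⟨k, (Fin.castLEEmb hle.le).trans e, fun n => ?_⟩
  have : lim (T k (e (Fin.castLE hle.le n))) = p := (he _).trans hc'
  rw [← this]
  exact hlim _

section Boundary

variable {V : Type*} [DecidableEq V]

theorem exists_bounded_exhaustion (t : V → Finset V) {d : ℕ}
    (hd : ∀ B : Finset V, ∃ A, B ⊆ A ∧ (A.biUnion t \ A).card ≤ d) (H : ℕ → Finset V) :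
    ∃ C : ℕ → Finset V, C 0 = ∅ ∧ (∀ i, ((C i).biUnion t \ C i).card ≤ d) ∧
      (∀ i, (C i).biUnion t ⊆ C (i + 1)) ∧ ∀ i, H i ⊆ C (i + 1) := by
  choose g hg hg' using hd
  let C : ℕ → Finset V := fun i => Nat.rec ∅ (fun i C => g (C.biUnion t ∪ H i)) i
  have hC : ∀ i, C (i + 1) = g ((C i).biUnion t ∪ H i) := fun _ => rfl
  refine ⟨C, rfl, ?_, fun i => ?_, fun i => ?_⟩
  · rintro (_ | i)
    · simp [C]
    · rw [hC]; exact hg' _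
  · rw [hC]; exact Finset.subset_union_left.trans (hg _)
  · rw [hC]; exact Finset.subset_union_right.trans (hg _)

/-- Patterns at a boundary of size at most `d` can be coded in a finite type depending only
on `d`. -/
theorem exists_pattern_code {G : SimpleGraph V} (t : V → Finset V)
    (ht : ∀ u v, G.Adj u v → v ∈ t u) {d : ℕ} (C : Finset V)
    (hC : (C.biUnion t \ C).card ≤ d) :
    ∃ code : (Bool × ℕ → V) → Set (Fin d) × Set (Fin d), ∀ r s, IsTwoRay G r → IsTwoRay G s →
      code r = code s → pattern (C : Set V) r = pattern (C : Set V) s := by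
  obtain ⟨e⟩ := Function.Embedding.nonempty_of_card_le
    (α := {x // x ∈ C.biUnion t \ C}) (β := Fin d) (by simpa using hC)
  let φ : Set V → Set (Fin d) := fun s => e '' {v | v.1 ∈ s}
  have hφ : ∀ D D' : V → V → Prop, (∀ u v, D u v → G.Adj u v) → (∀ u v, D' u v → G.Adj u v) →
      φ (crossing C D) = φ (crossing C D') → crossing (C : Set V) D = crossing (C : Set V) D' := by
    intro D D' hD hD' h
    have h1 := e.injective.image_injective h
    have h2 : ∀ E : V → V → Prop, (∀ u v, E u v → G.Adj u v) →
        ∀ v ∈ crossing (C : Set V) E, v ∈ C.biUnion t \ C := by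
      rintro E hE v ⟨hv, u, hu, huv⟩
      exact Finset.mem_sdiff.2 ⟨Finset.mem_biUnion.2 ⟨u, hu, ht u v (hE u v huv)⟩, hv⟩
    ext v
    constructor
    · intro hv
      exact (Set.ext_iff.1 h1 ⟨v, h2 D hD v hv⟩).1 hv
    · intro hv
      exact (Set.ext_iff.1 h1 ⟨v, h2 D' hD' v hv⟩).2 hv
  refine ⟨fun r => (φ (pattern C r).1, φ (pattern C r).2), fun r s hr hs h => ?_⟩
  obtain ⟨h1, h2⟩ := Prod.ext_iff.1 h
  exact Prod.ext (hφ _ _ (fun _ _ => hr.arc_adj) (fun _ _ => hs.arc_adj) h1)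
    (hφ _ _ (fun _ _ h => (hr.arc_adj h).symm) (fun _ _ h => (hs.arc_adj h).symm) h2)

theorem exists_infinite_family_of_bounded_boundary {G : SimpleGraph V} (t : V → Finset V)
    (ht' : ∀ v, v ∈ t v) (ht : ∀ u v, G.Adj u v → v ∈ t u) {d : ℕ}
    (hd : ∀ B : Finset V, ∃ A, B ⊆ A ∧ (A.biUnion t \ A).card ≤ d)
    (T : (k : ℕ) → Fin k → Bool × ℕ → V) (hT : ∀ k x, IsTwoRay G (T k x))
    (hdis : ∀ k x y, x ≠ y → ArcDisjoint (T k x) (T k y)) :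
    ∃ r : ℕ → Bool × ℕ → V, (∀ n, IsTwoRay G (r n)) ∧
      ∀ n m, n ≠ m → ArcDisjoint (r n) (r m) := by
  obtain ⟨H, hH⟩ := exists_finset_exhaustion
    (fun p : (Σ k, Fin k) × Bool × ℕ => T p.1.1 p.1.2 p.2)
  obtain ⟨C, hC0, hCd, hCt, hCH⟩ := exists_bounded_exhaustion t hd H
  have hCmono : Monotone C := monotone_nat_of_le_succ fun i v hv =>
    hCt i (Finset.mem_biUnion.2 ⟨v, hv, ht' v⟩)
  have hCev : ∀ k x p, ∀ᶠ i in Filter.atTop, T k x p ∈ C i := by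
    intro k x p
    obtain ⟨i₀, hi₀⟩ := Filter.eventually_atTop.1 (hH (⟨k, x⟩, p))
    filter_upwards [Filter.eventually_ge_atTop (i₀ + 1)] with i hi
    exact hCmono hi (hCH i₀ (hi₀ i₀ le_rfl))
  choose code hcode using fun i => exists_pattern_code (G := G) t ht (C i) (hCd i)
  obtain ⟨p, hp⟩ := exists_uniform_subfamilies T code
  choose k e he using hp
  let U : ℕ → ℕ → Bool × ℕ → V := fun c n =>
    if h : n < c then T (k c) (e c ⟨n, h⟩) else T 1 0
  have hUlt : ∀ c n (h : n < c), U c n = T (k c) (e c ⟨n, h⟩) := fun c n h => dif_pos h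
  have hU : ∀ c n, n < c → IsTwoRay G (U c n) := fun c n h => by
    rw [hUlt c n h]; exact hT _ _
  have hUcode : ∀ c, ∀ᶠ i in (Filter.hyperfilter ℕ : Filter ℕ), ∀ n ∈ Finset.range c,
      code i (U c n) = p := by
    intro c
    rw [Filter.eventually_all_finset]
    intro n hn
    rw [hUlt c n (Finset.mem_range.1 hn)]
    exact he c _
  -- Large sets of the ultrafilter intersect, so one boundary `C i'` shows the pattern code `p` for
  -- two successive families at once, and lies far enough out to contain the discarded head and the
  -- start of the new tail.
  have hnext : ∀ c i, ∃ i', i < i' ∧ (∀ n < c + 1, code i' (U (c + 1) n) = p) ∧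
      (∀ n < c + 2, code i' (U (c + 2) n) = p) ∧
      ∃ l, (∀ q, tail l (U (c + 1) c) q ∉ C i) ∧ ∀ b, ∀ j ≤ l, U (c + 1) c (b, j) ∈ C i' := by
    intro c i
    obtain ⟨l, hl⟩ := exists_tail_notMem (hU (c + 1) c (by omega)).inj (C i)
    have hhead : ∀ᶠ i' in Filter.atTop, ∀ b, ∀ j ∈ Finset.range (l + 1),
        U (c + 1) c (b, j) ∈ C i' := by
      rw [Filter.eventually_all]
      intro b
      rw [Filter.eventually_all_finset]
      intro j _
      rw [hUlt (c + 1) c (by omega)]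
      exact hCev _ _ _
    obtain ⟨i', h1, h2, h3, h4⟩ := ((hUcode (c + 1)).and ((hUcode (c + 2)).and
      ((hhead.filter_mono Nat.hyperfilter_le_atTop).and
        ((Filter.eventually_gt_atTop i).filter_mono Nat.hyperfilter_le_atTop)))).exists
    exact ⟨i', h4, fun n hn => h1 n (Finset.mem_range.2 hn),
      fun n hn => h2 n (Finset.mem_range.2 hn), l, hl,
      fun b j hj => h3 b j (Finset.mem_range.2 (by omega))⟩
  choose g hg hg1 hg2 l hl hl' using hnext
  let a : ℕ → ℕ := fun c => Nat.rec 0 (fun c i => g c i) c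
  have ha : ∀ c, a (c + 1) = g c (a c) := fun _ => rfl
  have hamono : StrictMono a := strictMono_nat_of_lt_succ fun c => hg c (a c)
  refine exists_infinite_family_of_patterns (A := fun c => (C (a c) : Set V)) ?_ ?_ ?_ U
    (fun c n => hU c n) ?_ ?_ (fun c => l c (a c)) (fun c => hl c (a c)) (fun c => hl' c (a c))
  · exact fun c c' h => Finset.coe_subset.2 (hCmono (hamono.monotone h))
  · simp [a, hC0]
  · intro c u v hu huv
    exact hCmono (hg c (a c)) (hCt _ (Finset.mem_biUnion.2 ⟨u, hu, ht u v huv⟩))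
  · intro c n hn m hm hnm
    rw [hUlt c n hn, hUlt c m hm]
    refine hdis _ _ _ fun h => hnm ?_
    simpa using (e c).injective h
  -- At level `0` the family is empty. At level `c + 1` both families have code `p` by the choice of
  -- `a (c + 1)`.
  · rintro (_ | c) n hn
    · omega
    · refine hcode _ _ _ (hU _ _ hn) (hU _ _ (by omega)) ?_
      rw [ha, hg1 c (a c) n hn, hg2 c (a c) n (by omega)]

end Boundary

/-! ### Rays from an avoiding injection, and the conclusion -/

/-- An injection moving every vertex along an edge or fixing it, whose range misses infinitely
many vertices, yields infinitely many vertex-disjoint `2`-rays. -/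
theorem exists_infinite_family_of_avoiding {V : Type*} {G : SimpleGraph V} {I : Set V}
    (hI : I.Infinite) {f : V → V} (hf : Function.Injective f)
    (hadj : ∀ v, f v ≠ v → G.Adj v (f v)) (hfI : ∀ v, f v ∉ I) :
    ∃ r : ℕ → Bool × ℕ → V, (∀ n, IsTwoRay G (r n)) ∧
      ∀ n m, n ≠ m → ArcDisjoint (r n) (r m) := by
  have hflow : IsFlow (fun u v => f u = v ∧ u ≠ v) :=
    { succ_unique := fun h1 h2 => h1.1.symm.trans h2.1
      pred_unique := fun h1 h2 => hf (h1.1.trans h2.1.symm)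
      continues := by
        rintro u v ⟨rfl, h⟩
        exact ⟨f (f u), rfl, fun h' => h (hf h')⟩ }
  have := hI.to_subtype
  obtain ⟨a⟩ : Nonempty (ℕ × Bool ↪ I) := by
    obtain ⟨e⟩ := nonempty_encodable (ℕ × Bool)
    exact ⟨(Encodable.encode' _).trans (Infinite.natEmbedding I)⟩
  obtain ⟨r, hr, hrD⟩ := hflow.exists_rays (fun i => (a i : V))
    (Subtype.val_injective.comp a.injective)
    -- Since `f` misses `I`, a point of `I` is not fixed and has no predecessor: it is a source.
    (fun i => ⟨_, rfl, fun h => hfI (a i) (h ▸ (a i).2)⟩)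
    (fun i u h => hfI u (h.1 ▸ (a i).2))
  refine ⟨fun n p => r ((n, p.1), p.2), fun n => ⟨?_, fun b m => ?_⟩, ?_⟩
  · intro p q h
    have := hr h
    simp only [Prod.mk.injEq, true_and] at this
    exact Prod.ext this.1 this.2
  · obtain ⟨h1, h2⟩ := hrD (n, b) m
    have := hadj _ (h1.trans_ne h2.symm)
    rwa [h1] at this
  · rintro n m hnm u v ⟨b, i, rfl, rfl⟩
    constructor <;> rintro ⟨b', i', h1, h2⟩
    · have := hr h1
      simp only [Prod.mk.injEq] at this
      exact hnm this.1.1.symm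
    · have := hr h1
      simp only [Prod.mk.injEq] at this
      exact hnm this.1.1.symm

theorem mainTheorem10 : IsEdgeUbiquitous.{u} twoRayGraph := by
  classical
  intro V G hG
  choose r hr hdis using fun k => (hG k).exists_isTwoRay
  obtain ⟨G', hle, hfin, s, hs, hsdis⟩ := exists_locallyFinite_le r hr hdis
  suffices h : ∃ r : ℕ → Bool × ℕ → V, (∀ n, IsTwoRay G' (r n)) ∧
      ∀ n m, n ≠ m → ArcDisjoint (r n) (r m) by
    obtain ⟨r, hr, hdis⟩ := h
    exact hasEdgeDisjointFamily_of_isTwoRay r (fun n => (hr n).mono hle) hdis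
  let t : V → Finset V := fun v => insert v (hfin v).toFinset
  have ht : ∀ v, v ∈ t v := fun v => Finset.mem_insert_self _ _
  have hadj : ∀ u v, G'.Adj u v → v ∈ t u := fun u v h =>
    Finset.mem_insert_of_mem ((hfin u).mem_toFinset.2 h)
  rcases infinite_avoiding_or_bounded_boundary t ht with ⟨I, hI, f, hf, hf'⟩ | ⟨d, hd⟩
  · refine exists_infinite_family_of_avoiding hI hf (fun v hv => ?_) fun v => (hf' v).2
    have := (Finset.mem_insert.1 (hf' v).1).resolve_left hv
    exact (hfin v).mem_toFinset.1 this
  · exact exists_infinite_family_of_bounded_boundary t ht hadj hd s hs hsdis
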